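/- A hypergraph $H$ has a finite vertex set $V(H)$ and a set $E(H)$ of edges, each edge being a subset of $V(H)$; $H$ is $r$-uniform if every edge has exactly $r$ vertices. The choice number $\mathrm{ch}(H)$ is the smallest positive integer $m$ such that, for every assignment of sets (lists) $L(v)$ of at least $m$ colors to the vertices $v\in V(H)$, there is a coloring $\varphi$ of $V(H)$ with $\varphi(v)\in L(v)$ for all $v$ and with no monochromatic edge. A local $m$-partition of $H$ is a collection $c=\{c_v\}_{v\in V(H)}$ of maps $c_v : E(v)\to\{1,\dots,m\}$, where $E(v)$ is the set of edges containing $v$. The single conflict chromatic number $\chi_{\nleftrightarrow}(H)$ is the smallest positive integer $m$ such that, for every local $m$-partition $\{c_v\}$ of $H$, there is a map $\varphi: V(H)\to\{1,\dots,m\}$ such that no edge $e$ satisfies $\varphi(v)=c_v(e)$ for all $v\in e$. **Proposition.** For every integer $k\ge 1$ and every integer $r\ge 2$ there are (finite) $r$-uniform hypergraphs $G_k$ and $H_k$ such that $$\chi_{\nleftrightarrow}(G_k)-\mathrm{ch}(G_k)\ \ge\ k \qquad\text{and}\qquad \mathrm{ch}(H_k)-\chi_{\nleftrightarrow}(H_k)\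 \ge\ k .$$ -/

import Mathlib

namespace Hypergraph

/-- `H` is `r`-uniform: every edge consists of exactly `r` vertices. -/
def IsUniform {α : Type*} (H : Hypergraph α) (r : ℕ) : Prop :=
  ∀ e ∈ H.edgeSet, e.encard = r

/-- `φ` is a proper coloring of `H`: no edge is monochromatic. (Values of `φ` outside the vertex
set play no role.) -/
def IsProperColoring {α κ : Type*} (H : Hypergraph α) (φ : α → κ) : Prop :=
  ∀ e ∈ H.edgeSet, ¬ ∃ a : κ, ∀ v ∈ e, φ v = a

/-- `H` is `L`-colorable: it has a proper coloring that picks at every vertex a color from the list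
of that vertex. -/
def IsListColorable {α κ : Type*} (H : Hypergraph α) (L : α → Finset κ) : Prop :=
  ∃ φ : α → κ, H.IsProperColoring φ ∧ ∀ v ∈ H.vertexSet, φ v ∈ L v

/-- `H` is `k`-choosable: it is `L`-colorable for every list assignment `L` in which all lists have
size at least `k`. The colors are natural numbers. -/
def IsChoosable {α : Type*} (H : Hypergraph α) (k : ℕ) : Prop :=
  ∀ L : α → Finset ℕ, (∀ v ∈ H.vertexSet, k ≤ (L v).card) → H.IsListColorable L

/-- The list-chromatic number (choice number) `ch(H)`: the smallest positive integer `k` such that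
`H` is `k`-choosable. -/
noncomputable def choiceNumber {α : Type*} (H : Hypergraph α) : ℕ :=
  sInf {k : ℕ | 0 < k ∧ H.IsChoosable k}

/-- `H` is conflict `c`-colorable, where `c v e` is the conflict color of the vertex `v` in the edge
`e`: there is a coloring `φ` of the vertices such that on no edge `e` all vertices `v` of `e` receive
their conflict color `c v e`. Only the values `c v e` with `v ∈ e ∈ E(H)` and `φ v` with
`v ∈ V(H)` play a role. -/
def IsConflictColorable {α κ : Type*} (H : Hypergraph α) (c : α → Set α → κ) : Prop :=
  ∃ φ : α → κ, ∀ e ∈ H.edgeSet, ¬ ∀ v ∈ e, φ v = c v e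

/-- `H` is conflict `c`-colorable for every local `k`-partition `c`. The colors `1, …, k` are
represented by the elements of `Fin k`. -/
def IsSingleConflictColorable {α : Type*} (H : Hypergraph α) (k : ℕ) : Prop :=
  ∀ c : α → Set α → Fin k, H.IsConflictColorable c

/-- The single conflict chromatic number: the smallest positive integer `k` such that `H` is conflict
`c`-colorable for every local `k`-partition `c`. (For `k = 0` the condition would be vacuously
true as soon as there is an edge, as there are no maps to the empty set of colors.) -/
noncomputable def singleConflictChromaticNumber {α : Type*} (H : Hypergraph α) : ℕ :=
  sInf {k : ℕ | 0 < k ∧ H.IsSingleConflictColorable k}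

/-- The minimum defining the choice number is over a nonempty set for a finite `r`-uniform
hypergraph, `r ≥ 2`. -/
theorem exists_isChoosable {α : Type*} (H : Hypergraph α) {r : ℕ} (hr : 2 ≤ r)
    (hV : H.vertexSet.Finite) (hH : H.IsUniform r) : ∃ k, 0 < k ∧ H.IsChoosable k := by
  classical
  have := hV.fintype
  refine ⟨Fintype.card H.vertexSet + 1, by omega, fun L hL => ?_⟩
  have hall : ∀ s : Finset H.vertexSet, s.card ≤ (s.biUnion fun v => L v).card := by
    intro s
    rcases s.eq_empty_or_nonempty with rfl | ⟨v, hv⟩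
    · simp
    · have h1 := Finset.card_le_card
        (Finset.subset_biUnion_of_mem (fun v : H.vertexSet => L v) hv)
      have h2 := hL v v.2
      have h3 := s.card_le_univ
      omega
  obtain ⟨f, hf, hfL⟩ := (Finset.all_card_le_biUnion_card_iff_exists_injective _).1 hall
  refine ⟨fun v => if h : v ∈ H.vertexSet then f ⟨v, h⟩ else 0, ?_, ?_⟩
  · rintro e he ⟨a, ha⟩
    have h1 : 1 < e.encard := by
      rw [hH e he]
      exact_mod_cast hr
    obtain ⟨x, y, hx, hy, hxy⟩ := Set.one_lt_encard_iff.1 h1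
    have hx' := H.subset_vertexSet_of_mem_edgeSet' he hx
    have hy' := H.subset_vertexSet_of_mem_edgeSet' he hy
    have hfx := ha x hx
    have hfy := ha y hy
    simp only [hx', hy', dif_pos] at hfx hfy
    exact hxy (congrArg Subtype.val (hf (hfx.trans hfy.symm)))
  · intro v hv
    simp only [hv, dif_pos]
    exact hfL ⟨v, hv⟩

/-- The minimum defining the single conflict chromatic number is over a nonempty set for a finite
`r`-uniform hypergraph, `r ≥ 2`. -/
theorem exists_isSingleConflictColorable {α : Type*} (H : Hypergraph α) {r : ℕ} (hr : 2 ≤ r)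
    (hV : H.vertexSet.Finite) (hH : H.IsUniform r) :
    ∃ k, 0 < k ∧ H.IsSingleConflictColorable k := by
  classical
  have hE : H.edgeSet.Finite :=
    hV.finite_subsets.subset fun e he => H.subset_vertexSet_of_mem_edgeSet' he
  refine ⟨hE.toFinset.card + 1, by omega, fun c => ?_⟩
  have key : ∀ v, ∃ a, a ∉ hE.toFinset.image (c v) := by
    intro v
    by_contra! h
    have h1 := Finset.card_le_card (fun a _ => h a : Finset.univ ⊆ hE.toFinset.image (c v))
    have h2 := Finset.card_image_le (s := hE.toFinset) (f := c v)
    simp only [Finset.card_univ, Fintype.card_fin] at h1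
    omega
  choose φ hφ using key
  refine ⟨φ, fun e he hc => ?_⟩
  have hne : e.Nonempty := by
    rw [← Set.encard_ne_zero, hH e he]
    exact_mod_cast (by omega : r ≠ 0)
  obtain ⟨v, hv⟩ := hne
  exact hφ v (Finset.mem_image.2 ⟨e, hE.mem_toFinset.2 he, (hc v hv).symm⟩)

end Hypergraph

/-! Complete hypergraphs give both gaps. On `n` vertices, the complete `r`-uniform one needs lists
of size at least `n / (r - 1)`, by pigeonhole for constant lists. Its degrees are at most `n ^ (r -
1)`, so about `2 * n ^ ((r - 1) / r)` conflict colors suffice. That bound is a counting substitute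
for the local lemma (`card_conflictFreeOn_le_two_mul_insert`).

In the complete `r`-partite one with parts of size `n`, reserving a random half of the colors for
one part shows that `ch` is at most logarithmic in `n`. A random local partition, however, defeats
every coloring even with a power of `n` many colors (`exists_forall_agree`). -/

namespace Hypergraph

/-! ### Conflict colorings under a degree bound -/

section Counting

variable {V : Type*} [Fintype V] [DecidableEq V] {m : ℕ}

/-- The colorings without a conflict on the edges contained in `S`. -/
def conflictFreeOn (E : Finset (Finset V)) (c : V → Finset V → Fin m) (S : Finset V) :
    Finset (V → Fin m) :=
  {φ | ∀ e ∈ E, e ⊆ S → ¬ ∀ v ∈ e, φ v = c v e}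

/-- Fixing the colors on a set `e` disjoint from `T` divides the number of conflict-free colorings
on `T` by `m ^ #e`. -/
theorem card_conflictFreeOn_fixed_mul_le (E : Finset (Finset V)) (c : V → Finset V → Fin m)
    {T e : Finset V} (h : Disjoint T e) (g : V → Fin m) :
    ((conflictFreeOn E c T).filter fun φ => ∀ v ∈ e, φ v = g v).card * m ^ e.card ≤
      (conflictFreeOn E c T).card := by
  have hcard : Fintype.card (e → Fin m) = m ^ e.card := by simp
  rw [← hcard, ← Finset.card_univ, ← Finset.card_product]
  -- Recoloring `e` arbitrarily is harmless: edges inside `T` miss `e`.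
  refine Finset.card_le_card_of_injOn
    (fun p v => if hv : v ∈ e then p.2 ⟨v, hv⟩ else p.1 v) ?_ ?_
  · rintro ⟨φ, ψ⟩ hp
    simp only [Finset.coe_product, Set.mem_prod, Finset.mem_coe, Finset.mem_filter,
      conflictFreeOn, Finset.mem_univ, true_and] at hp ⊢
    intro e' he' heT hc
    refine hp.1.1 e' he' heT fun v hv => ?_
    have hve : v ∉ e := Finset.disjoint_left.1 h (heT hv)
    simpa [hve] using hc v hv
  · rintro ⟨φ, ψ⟩ hp ⟨φ', ψ'⟩ hp' heq
    simp only [Finset.coe_product, Set.mem_prod, Finset.mem_coe, Finset.mem_filter] at hp hp'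
    have h1 : φ = φ' := by
      ext1 v
      by_cases hv : v ∈ e
      · rw [hp.1.2 v hv, hp'.1.2 v hv]
      · simpa [hv] using congrFun heq v
    have h2 : ψ = ψ' := by
      ext1 v
      simpa using congrFun heq v
    rw [h1, h2]

/-- In an `r`-uniform family with degrees at most `(m / 2) ^ r`, allowing one more vertex at most
halves the number of conflict-free colorings. -/
theorem card_conflictFreeOn_le_two_mul_insert {E : Finset (Finset V)} {r : ℕ} (hr : 0 < r)
    (hE : ∀ e ∈ E, e.card = r) (hd : ∀ v, (E.filter (v ∈ ·)).card * 2 ^ r ≤ m ^ r) (hm : 0 < m)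
    (c : V → Finset V → Fin m) (S : Finset V) {v : V} (hv : v ∉ S) :
    (conflictFreeOn E c S).card ≤ 2 * (conflictFreeOn E c (insert v S)).card := by
  induction hn : S.card using Nat.strong_induction_on generalizing S v with
  | _ n ih =>
  -- By induction, each vertex taken out of `S` at most doubles the count.
  have hdrop : ∀ T : Finset V, T ⊆ S →
      (conflictFreeOn E c (S \ T)).card ≤ 2 ^ T.card * (conflictFreeOn E c S).card := by
    intro T
    induction T using Finset.induction_on with
    | empty => simp
    | insert a T ha ihT =>
      intro hTS
      have haS : a ∈ S := hTS (Finset.mem_insert_self a T)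
      have h1 := ihT fun x hx => hTS (Finset.mem_insert_of_mem hx)
      have h2 : insert a (S \ insert a T) = S \ T := by
        ext x
        simp only [Finset.mem_insert, Finset.mem_sdiff]
        grind
      have h3 : a ∉ S \ insert a T := by simp
      have hlt : (S \ insert a T).card < n := by
        rw [← hn]
        refine Finset.card_lt_card ⟨Finset.sdiff_subset, fun h => h3 (h haS)⟩
      have h4 := ih _ hlt _ h3 rfl
      rw [h2] at h4
      rw [Finset.card_insert_of_notMem ha, pow_succ]
      nlinarith
  have hcover : conflictFreeOn E c S ⊆ conflictFreeOn E c (insert v S) ∪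
      ((E.filter (v ∈ ·)).filter (· ⊆ insert v S)).biUnion fun e =>
        (conflictFreeOn E c (S \ e.erase v)).filter fun φ => ∀ u ∈ e, φ u = c u e := by
    intro φ hφ
    simp only [conflictFreeOn, Finset.mem_filter, Finset.mem_univ, true_and, Finset.mem_union,
      Finset.mem_biUnion] at hφ ⊢
    by_cases h : ∀ e ∈ E, e ⊆ insert v S → ¬ ∀ u ∈ e, φ u = c u e
    · exact Or.inl h
    · push Not at h
      obtain ⟨e, he, heS, hc⟩ := h
      refine Or.inr ⟨e, ⟨⟨he, ?_⟩, heS⟩, fun e' he' h' =>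
        hφ e' he' (h'.trans Finset.sdiff_subset), hc⟩
      by_contra hve
      exact hφ e he ((Finset.subset_insert_iff_of_notMem hve).1 heS) hc
  -- Freeing the `r - 1` vertices of `e` in `S` costs `2 ^ (r - 1)`; fixing the colors on `e` then
  -- gains `m ^ r`.
  have hbad : ∀ e ∈ (E.filter (v ∈ ·)).filter (· ⊆ insert v S),
      ((conflictFreeOn E c (S \ e.erase v)).filter fun φ => ∀ u ∈ e, φ u = c u e).card * m ^ r ≤
        2 ^ (r - 1) * (conflictFreeOn E c S).card := by
    intro e he
    simp only [Finset.mem_filter] at he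
    obtain ⟨⟨heE, hve⟩, heS⟩ := he
    have hdis : Disjoint (S \ e.erase v) e := by
      rw [Finset.disjoint_left]
      intro x hx hxe
      simp only [Finset.mem_sdiff, Finset.mem_erase] at hx
      exact hx.2 ⟨fun h => hv (h ▸ hx.1), hxe⟩
    have h1 := card_conflictFreeOn_fixed_mul_le E c hdis fun u => c u e
    have h2 := hdrop (e.erase v) (Finset.subset_insert_iff.1 heS)
    rw [Finset.card_erase_of_mem hve, hE e heE] at h2
    rw [hE e heE] at h1
    exact h1.trans h2
  have h1 := (Finset.card_le_card hcover).trans (Finset.card_union_le _ _)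
  have h2 := Finset.card_biUnion_le (s := (E.filter (v ∈ ·)).filter (· ⊆ insert v S))
    (t := fun e => (conflictFreeOn E c (S \ e.erase v)).filter fun φ => ∀ u ∈ e, φ u = c u e)
  have h3 := Finset.sum_le_card_nsmul _ _ _ hbad
  rw [← Finset.sum_mul, smul_eq_mul] at h3
  have h4 : ((E.filter (v ∈ ·)).filter (· ⊆ insert v S)).card * 2 ^ r ≤ m ^ r :=
    (Nat.mul_le_mul_right _ (Finset.card_filter_le _ _)).trans (hd v)
  obtain ⟨s, rfl⟩ : ∃ s, r = s + 1 := ⟨r - 1, by omega⟩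
  simp only [add_tsub_cancel_right] at h3
  set B := ∑ e ∈ (E.filter (v ∈ ·)).filter (· ⊆ insert v S),
    ((conflictFreeOn E c (S \ e.erase v)).filter fun φ => ∀ u ∈ e, φ u = c u e).card
  have h5 : 2 * B ≤ (conflictFreeOn E c S).card := by
    refine Nat.le_of_mul_le_mul_right (c := m ^ (s + 1)) ?_ (by positivity)
    calc 2 * B * m ^ (s + 1) = 2 * (B * m ^ (s + 1)) := by ring
      _ ≤ 2 * _ := Nat.mul_le_mul_left _ h3
      _ = (((E.filter (v ∈ ·)).filter (· ⊆ insert v S)).card * 2 ^ (s + 1)) *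
            (conflictFreeOn E c S).card := by ring
      _ ≤ m ^ (s + 1) * (conflictFreeOn E c S).card := Nat.mul_le_mul_right _ h4
      _ = _ := mul_comm _ _
  omega

/-- Allowing the vertices one by one, the count at most halves each time, so it never reaches zero.
-/
theorem exists_conflictFree_of_degree_le {E : Finset (Finset V)} {r : ℕ} (hr : 0 < r)
    (hE : ∀ e ∈ E, e.card = r) (hd : ∀ v, (E.filter (v ∈ ·)).card * 2 ^ r ≤ m ^ r) (hm : 0 < m)
    (c : V → Finset V → Fin m) :
    ∃ φ : V → Fin m, ∀ e ∈ E, ¬ ∀ v ∈ e, φ v = c v e := by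
  have hpos : ∀ S : Finset V, 0 < (conflictFreeOn E c S).card := by
    intro S
    induction S using Finset.induction_on with
    | empty =>
      refine Finset.card_pos.2 ⟨fun _ => ⟨0, hm⟩, ?_⟩
      simp only [conflictFreeOn, Finset.mem_filter, Finset.mem_univ, true_and,
        Finset.subset_empty]
      rintro e he rfl
      have := hE _ he
      simp at this
      omega
    | insert a S ha ih =>
      have := card_conflictFreeOn_le_two_mul_insert hr hE hd hm c S ha
      omega
  obtain ⟨φ, hφ⟩ := Finset.card_pos.1 (hpos Finset.univ)
  simp only [conflictFreeOn, Finset.mem_filter, Finset.mem_univ, true_and] at hφ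
  exact ⟨φ, fun e he => hφ e he (Finset.subset_univ e)⟩

end Counting

/-! ### Complete uniform hypergraphs -/

/-- The complete `r`-uniform hypergraph on `n` vertices. -/
def completeUniform (n r : ℕ) : Hypergraph (Fin n) where
  vertexSet := Set.univ
  edgeSet := {e | e.encard = r}
  subset_vertexSet_of_mem_edgeSet' := fun _ _ => Set.subset_univ _

theorem isUniform_completeUniform (n r : ℕ) : (completeUniform n r).IsUniform r := fun _ he => he

theorem isSingleConflictColorable_completeUniform {n r m : ℕ} (hr : 0 < r) (hm : 0 < m)
    (h : n ^ (r - 1) * 2 ^ r ≤ m ^ r) : (completeUniform n r).IsSingleConflictColorable m := by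
  intro c
  have hd : ∀ v : Fin n,
      (((Finset.univ : Finset (Fin n)).powersetCard r).filter (v ∈ ·)).card * 2 ^ r ≤ m ^ r := by
    intro v
    refine (Nat.mul_le_mul_right _ ?_).trans h
    have h1 : (((Finset.univ : Finset (Fin n)).powersetCard r).filter (v ∈ ·)).card ≤
        ((Finset.univ : Finset (Fin n)).powersetCard (r - 1)).card := by
      refine Finset.card_le_card_of_injOn (fun e => e.erase v) ?_ ?_
      · intro e he
        simp only [Finset.coe_filter, Finset.mem_powersetCard_univ, Set.mem_ofPred_eq,
          Finset.mem_coe] at he ⊢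
        rw [Finset.card_erase_of_mem he.2, he.1]
      · intro e he e' he' heq
        simp only [Finset.coe_filter, Set.mem_ofPred_eq] at he he'
        rw [← Finset.insert_erase he.2, ← Finset.insert_erase he'.2]
        exact congrArg _ heq
    refine h1.trans ?_
    rw [Finset.card_powersetCard, Finset.card_univ, Fintype.card_fin]
    exact Nat.choose_le_pow _ _
  obtain ⟨φ, hφ⟩ := exists_conflictFree_of_degree_le hr
    (fun e he => (Finset.mem_powersetCard_univ.1 he)) hd hm fun v e => c v e
  refine ⟨φ, fun e he hc => ?_⟩
  have he' : e.encard = r := he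
  lift e to Finset (Fin n) using Set.toFinite e
  rw [Set.encard_coe_eq_coe_finsetCard] at he'
  exact hφ e (Finset.mem_powersetCard_univ.2 (by exact_mod_cast he')) fun v hv =>
    hc v (Finset.mem_coe.2 hv)

theorem le_mul_of_isChoosable_completeUniform {n r q : ℕ} (hr : 0 < r)
    (h : (completeUniform n r).IsChoosable q) : n ≤ q * (r - 1) := by
  by_contra! hlt
  obtain ⟨φ, hφ, hL⟩ := h (fun _ => Finset.range q) (by simp)
  have hmaps : ∀ v ∈ (Finset.univ : Finset (Fin n)), φ v ∈ Finset.range q :=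
    fun v _ => hL v (Set.mem_univ v)
  obtain ⟨a, -, ha⟩ := Finset.exists_lt_card_fiber_of_mul_lt_card_of_maps_to hmaps
    (n := r - 1) (by simpa using hlt)
  obtain ⟨e, he, hcard⟩ := Finset.exists_subset_card_eq (n := r)
    (s := Finset.univ.filter fun v => φ v = a) (by omega)
  refine hφ e ?_ ⟨a, fun v hv => (Finset.mem_filter.1 (he hv)).2⟩
  change (e : Set (Fin n)).encard = r
  rw [Set.encard_coe_eq_coe_finsetCard, hcard]

/-! ### List colorings of complete partite hypergraphs -/

/-- A hypergraph all of whose edges meet both `A` and its complement is `q`-choosable as soon as it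
has fewer than `2 ^ q` vertices. -/
theorem isChoosable_of_card_lt_two_pow {α : Type*} [Fintype α] (H : Hypergraph α) (A : Set α)
    (hA : ∀ e ∈ H.edgeSet, (∃ v ∈ e, v ∈ A) ∧ ∃ v ∈ e, v ∉ A) (hV : H.vertexSet = Set.univ)
    {q : ℕ} (hq : Fintype.card α < 2 ^ q) : H.IsChoosable q := by
  classical
  intro L hL
  simp only [hV, Set.mem_univ, forall_const] at hL
  set U := Finset.univ.biUnion L
  have hLU : ∀ v, L v ⊆ U := fun v => Finset.subset_biUnion_of_mem L (Finset.mem_univ v)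
  -- Union bound: `S` holds the colors reserved for `A`. It is bad for `v` if it misses `L v` (`v ∈
  -- A`) or contains it (`v ∉ A`), a fraction of at most `2 ^ (-q)` of all `S`.
  have hsplit : ∃ S ∈ U.powerset,
      S ∉ Finset.univ.biUnion fun v =>
        if v ∈ A then (U \ L v).powerset else Finset.Icc (L v) U := by
    by_contra! hall
    have h1 := Finset.card_le_card hall
    have h2 := h1.trans Finset.card_biUnion_le
    have h3 : ∀ v ∈ (Finset.univ : Finset α),
        (if v ∈ A then (U \ L v).powerset else Finset.Icc (L v) U).card * 2 ^ q ≤ 2 ^ U.card := by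
      intro v _
      have hc : (if v ∈ A then (U \ L v).powerset else Finset.Icc (L v) U).card =
          2 ^ (U.card - (L v).card) := by
        split_ifs
        · rw [Finset.card_powerset, Finset.card_sdiff_of_subset (hLU v)]
        · rw [Finset.card_Icc_finset (hLU v)]
      rw [hc, ← pow_add]
      have := Finset.card_le_card (hLU v)
      have := hL v
      exact Nat.pow_le_pow_right (by norm_num) (by omega)
    have h4 := Finset.sum_le_card_nsmul _ _ _ h3
    rw [← Finset.sum_mul, smul_eq_mul, Finset.card_univ] at h4
    rw [Finset.card_powerset] at h2
    have h5 := Nat.mul_le_mul_right (2 ^ q) h2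
    have h6 : 2 ^ U.card * 2 ^ q ≤ 2 ^ U.card * Fintype.card α := by linarith
    exact absurd (Nat.le_of_mul_le_mul_left h6 (by positivity)) (by omega)
  obtain ⟨S, hSU, hS⟩ := hsplit
  simp only [Finset.mem_biUnion, Finset.mem_univ, true_and, not_exists] at hS
  rw [Finset.mem_powerset] at hSU
  have hpick : ∀ v, ∃ a ∈ L v, a ∈ S ↔ v ∈ A := by
    intro v
    have := hS v
    by_contra! hno
    by_cases hv : v ∈ A
    · simp only [hv, if_true, Finset.mem_powerset] at this
      refine this fun a ha => Finset.mem_sdiff.2 ⟨hSU ha, fun hL => ?_⟩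
      have := hno a hL
      tauto
    · simp only [hv, if_false, Finset.mem_Icc] at this
      refine this ⟨fun a ha => ?_, hSU⟩
      have := hno a ha
      tauto
  choose φ hφL hφS using hpick
  refine ⟨φ, ?_, fun v _ => hφL v⟩
  rintro e he ⟨a, ha⟩
  obtain ⟨⟨u, hu, huA⟩, w, hw, hwA⟩ := hA e he
  have h1 := (hφS u).2 huA
  rw [ha u hu] at h1
  exact hwA ((hφS w).1 (by rwa [ha w hw]))

/-- The edge of the complete `r`-partite hypergraph that picks `f i` from the `i`-th part. -/
def transversal {r n : ℕ} (f : Fin r → Fin n) : Set (Fin r × Fin n) := Set.range fun i => (i, f i)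

theorem transversal_injective {r n : ℕ} :
    Function.Injective (transversal : (Fin r → Fin n) → Set (Fin r × Fin n)) := by
  intro f g h
  ext1 i
  have : (i, f i) ∈ transversal g := h ▸ ⟨i, rfl⟩
  obtain ⟨j, hj⟩ := this
  simp only [Prod.mk.injEq] at hj
  obtain ⟨rfl, hj⟩ := hj
  exact hj.symm

/-- The complete `r`-partite `r`-uniform hypergraph with parts of size `n`. -/
def completePartite (r n : ℕ) : Hypergraph (Fin r × Fin n) where
  vertexSet := Set.univ
  edgeSet := Set.range transversal
  subset_vertexSet_of_mem_edgeSet' := fun _ _ => Set.subset_univ _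

theorem isUniform_completePartite (r n : ℕ) : (completePartite r n).IsUniform r := by
  rintro _ ⟨f, rfl⟩
  rw [transversal, ← Set.image_univ, Function.Injective.encard_image]
  · simp
  · exact fun i j h => (Prod.mk.inj h).1

theorem isChoosable_completePartite {r n q : ℕ} (hr : 2 ≤ r) (hq : r * n < 2 ^ q) :
    (completePartite r n).IsChoosable q := by
  refine isChoosable_of_card_lt_two_pow _ {v | v.1 = ⟨0, by omega⟩} ?_ rfl (by simpa using hq)
  rintro _ ⟨f, rfl⟩
  exact ⟨⟨_, ⟨⟨0, by omega⟩, rfl⟩, rfl⟩, _, ⟨⟨1, by omega⟩, rfl⟩, by simp⟩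

/-! ### Random local partitions -/

/-- If `g : X → (F → C)` is a family of fewer than `(#C / (#C - 1)) ^ #F` functions, then there is a
function that agrees with each of them somewhere. -/
theorem exists_forall_agree {X F C : Type*} [Fintype X] [Fintype F] [Fintype C] [DecidableEq F]
    (g : X → F → C)
    (h : Fintype.card X * (Fintype.card C - 1) ^ Fintype.card F <
      Fintype.card C ^ Fintype.card F) :
    ∃ c : F → C, ∀ x, ∃ f, g x f = c f := by
  classical
  by_contra! hno
  have hcov : (Finset.univ : Finset (F → C)) ⊆
      Finset.univ.biUnion fun x => Fintype.piFinset fun f => Finset.univ.erase (g x f) := by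
    intro c _
    obtain ⟨x, hx⟩ := hno c
    simp only [Finset.mem_biUnion, Finset.mem_univ, true_and, Fintype.mem_piFinset,
      Finset.mem_erase, and_true]
    exact ⟨x, fun f => (hx f).symm⟩
  have h1 := (Finset.card_le_card hcov).trans Finset.card_biUnion_le
  simp only [Fintype.card_piFinset, Finset.card_erase_of_mem (Finset.mem_univ _),
    Finset.card_univ, Finset.prod_const, Finset.sum_const, smul_eq_mul, Fintype.card_fun] at h1
  omega

theorem two_mul_pred_pow_self_le {M : ℕ} (hM : 0 < M) : 2 * (M - 1) ^ M ≤ M ^ M := by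
  obtain ⟨N, rfl⟩ : ∃ N, M = N + 1 := ⟨M - 1, by omega⟩
  -- The top two binomial terms, `N ^ (N + 1)` and `(N + 1) * N ^ N`, suffice.
  rw [add_tsub_cancel_right, add_pow N 1 (N + 1), Finset.sum_range_succ, Finset.sum_range_succ]
  simp
  ring_nf
  omega

/-- With `M = (2 ^ t) ^ r` conflict patterns per edge and `M * s` edges, a fixed coloring survives a
random choice with probability `(1 - 1 / M) ^ (M * s) ≤ 2 ^ (-s)`, and there are only `2 ^ (t * r *
n)` colorings. -/
theorem not_isSingleConflictColorable_completePartite {r n t s : ℕ}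
    (hn : n ^ r = (2 ^ t) ^ r * s) (hs : t * (r * n) < s) :
    ¬ (completePartite r n).IsSingleConflictColorable (2 ^ t) := by
  intro hcol
  have hcard : Fintype.card (Fin r × Fin n → Fin (2 ^ t)) *
      (Fintype.card (Fin r → Fin (2 ^ t)) - 1) ^ Fintype.card (Fin r → Fin n) <
        Fintype.card (Fin r → Fin (2 ^ t)) ^ Fintype.card (Fin r → Fin n) := by
    simp only [Fintype.card_fun, Fintype.card_prod, Fintype.card_fin]
    rw [hn]
    set M := (2 ^ t) ^ r
    have hM : 0 < M := by positivity
    have h1 := Nat.pow_le_pow_left (two_mul_pred_pow_self_le hM) s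
    rw [mul_pow, ← pow_mul, ← pow_mul] at h1
    have h2 : (2 ^ t) ^ (r * n) < 2 ^ s := by
      rw [← pow_mul]
      exact Nat.pow_lt_pow_right (by norm_num) hs
    rcases Nat.eq_zero_or_pos ((M - 1) ^ (M * s)) with h0 | h0
    · rw [h0, mul_zero]
      positivity
    · exact (Nat.mul_lt_mul_of_pos_right h2 h0).trans_le h1
  obtain ⟨c, hc⟩ := exists_forall_agree
    (fun (φ : Fin r × Fin n → Fin (2 ^ t)) (f : Fin r → Fin n) (i : Fin r) => φ (i, f i)) hcard
  have hinv : ∀ f : Fin r → Fin n, ∃ f', transversal f' = transversal f := fun f => ⟨f, rfl⟩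
  classical
  obtain ⟨φ, hφ⟩ := hcol fun v e =>
    if h : ∃ f : Fin r → Fin n, transversal f = e then c h.choose v.1 else ⟨0, by positivity⟩
  obtain ⟨f, hf⟩ := hc φ
  refine hφ _ ⟨f, rfl⟩ ?_
  rintro _ ⟨i, rfl⟩
  beta_reduce
  rw [dif_pos (hinv f), transversal_injective (hinv f).choose_spec]
  exact congrFun hf i

/-- A coloring using only the first `j` colors never meets a conflict color beyond them, so these
may be replaced by `0`. -/
theorem IsSingleConflictColorable.mono {α : Type*} {H : Hypergraph α} {j m : ℕ} (hj : 0 < j)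
    (hjm : j ≤ m) (h : H.IsSingleConflictColorable j) : H.IsSingleConflictColorable m := by
  intro c
  obtain ⟨φ, hφ⟩ := h fun v e => if hlt : (c v e : ℕ) < j then ⟨c v e, hlt⟩ else ⟨0, hj⟩
  refine ⟨fun v => Fin.castLE hjm (φ v), fun e he hc => hφ e he fun v hv => ?_⟩
  have h1 : (φ v : ℕ) = c v e := congrArg Fin.val (hc v hv)
  have h2 : (c v e : ℕ) < j := h1 ▸ (φ v).isLt
  beta_reduce
  rw [dif_pos h2]
  exact Fin.ext h1

end Hypergraph

theorem mainTheorem11 (k r : ℕ) (hk : 1 ≤ k) (hr : 2 ≤ r) :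
    (∃ (V : Type) (G : Hypergraph V), G.vertexSet.Finite ∧ G.IsUniform r ∧
      (G.singleConflictChromaticNumber : ℤ) - (G.choiceNumber : ℤ) ≥ (k : ℤ)) ∧
    (∃ (V : Type) (H : Hypergraph V), H.vertexSet.Finite ∧ H.IsUniform r ∧
      (H.choiceNumber : ℤ) - (H.singleConflictChromaticNumber : ℤ) ≥ (k : ℤ)) := by
  constructor
  -- `t` is chosen so that `2 ^ t ≥ 4 * t ≥ 3 * t + 2 * r + k`. The cube in `n` makes the number of
  -- edges per pattern, `r ^ r * (2 ^ t) ^ (2 * r)`, exceed `t * (r * n)`.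
  · set t := 2 * r + k + 4 with ht
    set n := r * (2 ^ t) ^ 3 with hn
    refine ⟨_, Hypergraph.completePartite r n, Set.toFinite _,
      Hypergraph.isUniform_completePartite r n, ?_⟩
    have h4t : ∀ t : ℕ, 4 ≤ t → 4 * t ≤ 2 ^ t := by
      intro t ht
      induction t, ht using Nat.le_induction with
      | base => norm_num
      | succ t ht ih => rw [pow_succ]; omega
    have htt := h4t t (by omega)
    have hch : (Hypergraph.completePartite r n).choiceNumber ≤ 3 * t + 2 * r := by
      refine Nat.sInf_le ⟨by omega, Hypergraph.isChoosable_completePartite hr ?_⟩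
      have hr2 : r < 2 ^ r := Nat.lt_two_pow_self
      have hr3 : r * r < 2 ^ r * 2 ^ r := Nat.mul_self_lt_mul_self hr2
      calc r * n = (r * r) * (2 ^ t) ^ 3 := by rw [hn]; ring
        _ < (2 ^ r * 2 ^ r) * (2 ^ t) ^ 3 := Nat.mul_lt_mul_of_pos_right hr3 (by positivity)
        _ = 2 ^ (3 * t + 2 * r) := by rw [← pow_mul, ← pow_add, ← pow_add]; congr 1; ring
    have hχ : 2 ^ t < (Hypergraph.completePartite r n).singleConflictChromaticNumber := by
      obtain ⟨hpos, hcol⟩ := Nat.sInf_mem (Hypergraph.exists_isSingleConflictColorable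
        (Hypergraph.completePartite r n) hr (Set.toFinite _)
        (Hypergraph.isUniform_completePartite r n))
      by_contra! hle
      refine Hypergraph.not_isSingleConflictColorable_completePartite
        (s := r ^ r * (2 ^ t) ^ (2 * r)) ?_ ?_ (hcol.mono hpos hle)
      · rw [hn, mul_pow, mul_left_comm, ← pow_mul (2 ^ t), ← pow_add]
        congr 2
        ring
      · have h1 : r ^ 2 ≤ r ^ r := Nat.pow_le_pow_right (by omega) hr
        have h2 : (2 ^ t) ^ 4 ≤ (2 ^ t) ^ (2 * r) :=
          Nat.pow_le_pow_right (by positivity) (by omega)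
        have h3 : t < 2 ^ t := Nat.lt_two_pow_self
        calc t * (r * n) = t * (r ^ 2 * (2 ^ t) ^ 3) := by rw [hn]; ring
          _ < 2 ^ t * (r ^ 2 * (2 ^ t) ^ 3) := Nat.mul_lt_mul_of_pos_right h3 (by positivity)
          _ = r ^ 2 * (2 ^ t) ^ 4 := by ring
          _ ≤ _ := Nat.mul_le_mul h1 h2
    omega
  · obtain ⟨s, rfl⟩ : ∃ s, r = s + 1 := ⟨r - 1, by omega⟩
    -- With `n = x ^ (s + 1)`, the degree condition for `2 * x ^ s` colors is an equality, and `n /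
    -- s = (k + 2) * x ^ s`.
    set x := s * (k + 2) with hx
    have hxpos : 0 < x := by
      have : 0 < s := by omega
      positivity
    refine ⟨_, Hypergraph.completeUniform (x ^ (s + 1)) (s + 1), Set.toFinite _,
      Hypergraph.isUniform_completeUniform _ _, ?_⟩
    have hχ : (Hypergraph.completeUniform (x ^ (s + 1)) (s + 1)).singleConflictChromaticNumber ≤
        2 * x ^ s := by
      refine Nat.sInf_le ⟨by positivity,
        Hypergraph.isSingleConflictColorable_completeUniform (by omega) (by positivity)
          (le_of_eq ?_)⟩
      rw [add_tsub_cancel_right, mul_pow 2, ← pow_mul, ← pow_mul, mul_comm s]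
      exact mul_comm _ _
    obtain ⟨-, hcol⟩ := Nat.sInf_mem (Hypergraph.exists_isChoosable
      (Hypergraph.completeUniform (x ^ (s + 1)) (s + 1)) hr (Set.toFinite _)
      (Hypergraph.isUniform_completeUniform _ _))
    have hch := Hypergraph.le_mul_of_isChoosable_completeUniform (by omega) hcol
    change _ ≤ (Hypergraph.completeUniform (x ^ (s + 1)) (s + 1)).choiceNumber * _ at hch
    rw [add_tsub_cancel_right] at hch
    have h1 : x ^ s * (k + 2) ≤
        (Hypergraph.completeUniform (x ^ (s + 1)) (s + 1)).choiceNumber := by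
      refine Nat.le_of_mul_le_mul_right (c := s) ?_ (by omega)
      calc x ^ s * (k + 2) * s = x ^ s * x := by rw [hx]; ring
        _ = x ^ (s + 1) := (pow_succ _ _).symm
        _ ≤ _ := hch
    have h2 : 1 ≤ x ^ s := Nat.one_le_pow _ _ hxpos
    have h3 : k ≤ x ^ s * k := Nat.le_mul_of_pos_left k h2
    rw [mul_add] at h1
    omega
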